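/- Write $\delta$ for the Dirac impulse at time $0$. A (causal) impulse response is an expression $h=c\,\delta+k$ with $c\in\mathbb{R}$ and $k:[0,\infty)\to\mathbb{R}$. It is *the impulse response of* a transfer function $H$ if there is $\sigma\in\mathbb{R}$ such that, for all $s\in\mathbb{C}$ with $\operatorname{Re}s>\sigma$, the integral $\int_0^\infty e^{-st}k(t)\,dt$ converges absolutely and $c+\int_0^\infty e^{-st}k(t)\,dt=H(s)$. It is *nonnegative* if $c\ge 0$ and $k(t)\ge 0$ for almost every $t\ge 0$; its $L_1$-norm is $\|h\|_1=|c|+\int_0^\infty|k(t)|\,dt$; and it is *BIBO-stable* if for every $u\in L_\infty[0,\infty)$ the output $(h*u)(t)=c\,u(t)+\int_0^t k(\tau)u(t-\tau)\,d\tau$ belongs to $L_\infty[0,\infty)$. Lemma. Let $Z$ be a rational function with real coefficients (an integer order transfer function) that has an impulse response $z$ which is BIBO-stable and nonnegative, and let $0<\alpha<1$. Then $Z$ has no pole at $0$; the fractional order transfer function $s\mapsto Z(s^\alpha)$ (principal branch of the power) has an impulse response; and every impulse response $w$ of $Z(s^\alpha)$ is nonnegative and has finite $L_1$-norm, with $$\|w\|_1=Z(0).$$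 -/

import Mathlib

open MeasureTheory Set

noncomputable section

/-- A causal (generalized) impulse response `direct • δ + kernel`, supported on `[0, ∞)`: a Dirac
impulse at time `0` (the direct feedthrough of a transfer function that is proper but not strictly
proper) plus a function of time. The values of `kernel` at negative times play no role. -/
structure ImpulseResponse where
  /-- The coefficient of the Dirac impulse at time `0`. -/
  direct : ℝ
  /-- The function part, considered on `[0, ∞)`. -/
  kernel : ℝ → ℝ

namespace ImpulseResponse

/-- `h` is the impulse response of the system with transfer function `H`: in some right half-plane
the Laplace transform of `h` converges absolutely and equals `H`. -/
def IsResponseOf (h : ImpulseResponse) (H : ℂ → ℂ) : Prop :=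
  ∃ σ : ℝ, ∀ s : ℂ, σ < s.re →
    IntegrableOn (fun t : ℝ => Complex.exp (-s * t) * (h.kernel t : ℂ)) (Ioi 0) ∧
    (h.direct : ℂ) + ∫ t in Ioi (0 : ℝ), Complex.exp (-s * t) * (h.kernel t : ℂ) = H s

/-- The output `h * u` at time `t` for an input `u` that starts at time `0`. -/
def output (h : ImpulseResponse) (u : ℝ → ℝ) (t : ℝ) : ℝ :=
  h.direct * u t + ∫ τ in (0 : ℝ)..t, h.kernel τ * u (t - τ)

/-- Bounded-input bounded-output stability: every input in `L^∞[0, ∞)` has its output in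
`L^∞[0, ∞)`. -/
def BIBOStable (h : ImpulseResponse) : Prop :=
  ∀ u : ℝ → ℝ, MemLp u ⊤ (volume.restrict (Ici 0)) →
    MemLp (h.output u) ⊤ (volume.restrict (Ici 0))

/-- Nonnegativity of `direct • δ + kernel` on `[0, ∞)`. -/
def Nonneg (h : ImpulseResponse) : Prop :=
  0 ≤ h.direct ∧ ∀ᵐ t ∂(volume.restrict (Ici (0 : ℝ))), 0 ≤ h.kernel t

/-- Finiteness of the `L¹`-norm. -/
def MemL1 (h : ImpulseResponse) : Prop :=
  IntegrableOn h.kernel (Ici 0)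

/-- The `L¹`-norm (total variation) of `direct • δ + kernel`; meaningful when `h.MemL1`. -/
def l1Norm (h : ImpulseResponse) : ℝ :=
  |h.direct| + ∫ t in Ici (0 : ℝ), |h.kernel t|

end ImpulseResponse

/-- The integer order transfer function `s ↦ Z(s)` of a real rational function `Z`. -/
def transferFunction (Z : RatFunc ℝ) (s : ℂ) : ℂ :=
  Z.eval (algebraMap ℝ ℂ) s

/-- The fractional order transfer function `s ↦ Z(s ^ α)`, with the principal branch of the
power. -/
def fractionalTransferFunction (Z : RatFunc ℝ) (α : ℝ) (s : ℂ) : ℂ :=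
  transferFunction Z (s ^ (α : ℂ))

end

/-!
Write `z = c δ + k`. The unit step response `c + ∫₀ᵗ k` is essentially bounded and, as `k ≥ 0`,
monotone; hence `k` is integrable (`ImpulseResponse.BIBOStable.integrableOn`). Its Laplace transform
is then analytic on `Re s > 0` and continuous up to `0`, and there it satisfies
`(c + ∫ e^{-st} k) * denom = num` by analytic continuation. As `num` and `denom` are coprime, `0` is
not a pole and `Z(0) = c + ∫ k` (`eval_zero_of_integrable`).

*Existence of a response of `Z(s ^ α)`.* Since `c + ∫ e^{-st} k` is bounded at infinity, `Z` is
proper, so it is a convergent series `∑ bₙ s⁻ⁿ` near infinity. Then `Z(s ^ α) = ∑ bₙ s ^ (-αn)`, and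
the terms are the Laplace transforms of multiples of `t ^ (αn - 1) / Γ(αn)`
(`exists_isResponseOf_of_hasSum`).

*Nonnegativity.* For `s > 0`, `Z(s ^ α) = c + φ(s)` with `φ(s) = ∫ e^{-τ s ^ α} k(τ) dτ`. Each
`e^{-τ s ^ α}` is the Laplace transform of a probability measure (the law of a stable subordinator),
so `φ` is the transform of a positive measure. Instead of constructing these measures the proof uses
a condition that Laplace transforms of positive measures satisfy and that can be checked on the
transforms themselves (`HausdorffPositive`): `∑ aⱼ φ(s + j) ≥ 0` for all `s > 0` and all polynomials
`∑ aⱼ Xʲ` nonnegative on `[0, 1]`. The functions whose multiplication preserves this condition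
(`HausdorffMultiplier`) contain `e^{-xs}` and are closed under sums, products, integrals, pointwise
limits and exponentials. The integral representation of `s ^ α` in terms of `(t + s)⁻¹` then shows
that they contain `e^{-τ s ^ α}`, and averaging over `k(τ) dτ` shows that `φ` is Hausdorff positive.

Let `w = c' δ + k'` be a response of `Z(s ^ α)`. Letting `s → ∞` gives `c' = c`, so `φ` is the
Laplace transform of `k'` near infinity. By the Weierstrass theorem Hausdorff positivity gives
`k' ≥ 0` (`HausdorffPositive.ae_nonneg`), and, as `φ ≤ ∫ k`, it also gives the integrability of `k'`
(`HausdorffPositive.integrableOn`). Now `c' + ∫ e^{-st} k' = Z(s ^ α)` extends to `Re s > 0`, and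
`s → 0` gives `c' + ∫ k' = c + ∫ k = Z(0)`.
-/

open Filter Topology Polynomial

/-! ### Hausdorff positive functions and their multipliers -/

/-- `shiftSum p φ s = ∑ⱼ aⱼ φ(s + j)` for a polynomial `p = ∑ⱼ aⱼ Xʲ`. When `φ` is the Laplace
transform of a measure `μ` this is `∫ e^{-st} p(e^{-t}) dμ(t)`. -/
noncomputable def shiftSum (p : ℝ[X]) (φ : ℝ → ℝ) (s : ℝ) : ℝ :=
  p.sum fun j a => a * φ (s + j)

lemma shiftSum_eq_sum_range {p : ℝ[X]} {n : ℕ} (hn : p.natDegree < n) (φ : ℝ → ℝ) (s : ℝ) :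
    shiftSum p φ s = ∑ j ∈ Finset.range n, p.coeff j * φ (s + j) :=
  p.sum_over_range' (fun _ => by simp) n hn

/-- `φ` is *Hausdorff positive* if each of the sequences `j ↦ φ(s + j)`, `s > 0`, defines a positive
functional on polynomials on `[0, 1]`. This is the property of Laplace transforms of positive
measures that survives pointwise limits, and it is formulated without reference to a measure. -/
def HausdorffPositive (φ : ℝ → ℝ) : Prop :=
  ∀ p : ℝ[X], (∀ x ∈ Icc (0 : ℝ) 1, 0 ≤ p.eval x) → ∀ s, 0 < s → 0 ≤ shiftSum p φ s

lemma hausdorffPositive_one : HausdorffPositive fun _ => 1 := by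
  intro p hp s _
  have := hp 1 (by simp)
  rw [eval_eq_sum] at this
  simpa [shiftSum] using this

lemma HausdorffPositive.of_tendsto {ι : Type*} {l : Filter ι} [l.NeBot] {Φ : ι → ℝ → ℝ}
    {φ : ℝ → ℝ} (hΦ : ∀ᶠ i in l, HausdorffPositive (Φ i))
    (h : ∀ s, 0 < s → Tendsto (fun i => Φ i s) l (𝓝 (φ s))) : HausdorffPositive φ := by
  intro p hp s hs
  have : Tendsto (fun i => shiftSum p (Φ i) s) l (𝓝 (shiftSum p φ s)) :=
    tendsto_finsetSum _ fun j _ => (h _ (by positivity)).const_mul _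
  exact ge_of_tendsto this (hΦ.mono fun i hi => hi p hp s hs)

/-- Averages of Hausdorff positive functions are Hausdorff positive. -/
lemma HausdorffPositive.integral {β : Type*} [MeasurableSpace β] {μ : Measure β}
    {Φ : β → ℝ → ℝ} (hΦ : ∀ᵐ b ∂μ, HausdorffPositive (Φ b))
    (hint : ∀ s, 0 < s → Integrable (fun b => Φ b s) μ) :
    HausdorffPositive fun s => ∫ b, Φ b s ∂μ := by
  intro p hp s hs
  have : shiftSum p (fun s => ∫ b, Φ b s ∂μ) s = ∫ b, shiftSum p (Φ b) s ∂μ := by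
    simp only [shiftSum, Polynomial.sum_def]
    rw [integral_finsetSum _ fun j _ => (hint _ (by positivity)).const_mul _]
    simp [integral_const_mul]
  rw [this]
  exact integral_nonneg_of_ae (hΦ.mono fun b hb => hb p hp s hs)

/-- Multiplication by `m` preserves Hausdorff positivity. Multipliers replace convolution of
measures: `exp` of a multiplier is again one because multipliers form a closed cone stable under
products. -/
def HausdorffMultiplier (m : ℝ → ℝ) : Prop :=
  ∀ φ, HausdorffPositive φ → HausdorffPositive fun s => m s * φ s

namespace HausdorffMultiplier

variable {m m₁ m₂ : ℝ → ℝ}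

lemma hausdorffPositive (hm : HausdorffMultiplier m) : HausdorffPositive m := by
  simpa using hm _ hausdorffPositive_one

lemma const {c : ℝ} (hc : 0 ≤ c) : HausdorffMultiplier fun _ => c := by
  intro φ hφ p hp s hs
  have : shiftSum p (fun s => c * φ s) s = c * shiftSum p φ s := by
    simp only [shiftSum, Polynomial.sum_def, Finset.mul_sum]
    exact Finset.sum_congr rfl fun _ _ => by ring
  rw [this]
  exact mul_nonneg hc (hφ p hp s hs)

lemma add (h₁ : HausdorffMultiplier m₁) (h₂ : HausdorffMultiplier m₂) :
    HausdorffMultiplier fun s => m₁ s + m₂ s := by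
  intro φ hφ p hp s hs
  have := add_nonneg (h₁ φ hφ p hp s hs) (h₂ φ hφ p hp s hs)
  simpa only [shiftSum, Polynomial.sum_def, ← Finset.sum_add_distrib, ← mul_add, ← add_mul]
    using this

lemma mul (h₁ : HausdorffMultiplier m₁) (h₂ : HausdorffMultiplier m₂) :
    HausdorffMultiplier fun s => m₁ s * m₂ s := by
  intro φ hφ
  simpa only [mul_assoc] using h₁ _ (h₂ φ hφ)

lemma pow (hm : HausdorffMultiplier m) (n : ℕ) : HausdorffMultiplier fun s => m s ^ n := by
  induction n with
  | zero => simpa using const zero_le_one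
  | succ n ih => simpa only [pow_succ] using ih.mul hm

lemma sum {ι : Type*} (S : Finset ι) {M : ι → ℝ → ℝ} (hM : ∀ i, HausdorffMultiplier (M i)) :
    HausdorffMultiplier fun s => ∑ i ∈ S, M i s := by
  classical
  induction S using Finset.induction_on with
  | empty => simpa using const le_rfl
  | insert i S hi ih => simpa only [Finset.sum_insert hi] using (hM i).add ih

lemma of_tendsto {ι : Type*} {l : Filter ι} [l.NeBot] {M : ι → ℝ → ℝ}
    (hM : ∀ᶠ i in l, HausdorffMultiplier (M i))
    (h : ∀ s, 0 < s → Tendsto (fun i => M i s) l (𝓝 (m s))) : HausdorffMultiplier m :=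
  fun φ hφ => .of_tendsto (hM.mono fun _ hi => hi φ hφ) fun s hs => (h s hs).mul_const _

lemma exp (hm : HausdorffMultiplier m) : HausdorffMultiplier fun s => Real.exp (m s) := by
  refine of_tendsto (l := atTop)
    (M := fun n s => ∑ i ∈ Finset.range n, (i.factorial : ℝ)⁻¹ * m s ^ i)
    (.of_forall fun n => sum _ fun i => (const (by positivity)).mul (hm.pow i)) fun s _ => ?_
  have := (NormedSpace.expSeries_div_hasSum_exp (m s)).tendsto_sum_nat
  simpa only [Real.exp_eq_exp_ℝ, div_eq_inv_mul] using this

lemma integral {β : Type*} [MeasurableSpace β] {μ : Measure β}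
    {M : β → ℝ → ℝ} (hM : ∀ᵐ b ∂μ, HausdorffMultiplier (M b))
    (hint : ∀ s, 0 < s → Integrable (fun b => M b s) μ) :
    HausdorffMultiplier fun s => ∫ b, M b s ∂μ := by
  intro φ hφ
  simp only [← integral_mul_const]
  exact .integral (hM.mono fun b hb => hb φ hφ) fun s hs => (hint s hs).mul_const _

/-- Multiplication by `e^{-xs}` turns the functional `p ↦ shiftSum p φ s` into a multiple of
`p ↦ shiftSum (p(e^{-x} X)) φ s`, and `e^{-x} [0, 1] ⊆ [0, 1]`. -/
lemma exp_neg_mul {x : ℝ} (hx : 0 ≤ x) : HausdorffMultiplier fun s => Real.exp (-(x * s)) := by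
  intro φ hφ p hp s hs
  set q : ℝ[X] := p.comp (C (Real.exp (-x)) * X) with hq
  have h : shiftSum p (fun s => Real.exp (-(x * s)) * φ s) s =
      Real.exp (-(x * s)) * shiftSum q φ s := by
    rw [shiftSum_eq_sum_range (n := p.natDegree + q.natDegree + 1) (by omega),
      shiftSum_eq_sum_range (n := p.natDegree + q.natDegree + 1) (by omega), Finset.mul_sum]
    refine Finset.sum_congr rfl fun j _ => ?_
    rw [hq, comp_C_mul_X_coeff, ← Real.exp_nat_mul,
      show -(x * (s + j)) = -(x * s) + j * -x by ring, Real.exp_add]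
    ring
  rw [h]
  refine mul_nonneg (Real.exp_nonneg _) (hφ q (fun y hy => ?_) s hs)
  simp only [hq, eval_comp, eval_mul, eval_C, eval_X]
  refine hp _ ⟨mul_nonneg (Real.exp_nonneg _) hy.1, ?_⟩
  exact mul_le_one₀ (Real.exp_le_one_iff.2 (by linarith)) hy.1 hy.2

/-- `(t + s)⁻¹ = ∫₀^∞ e^{-tx} e^{-xs} dx` is an average of exponentials. -/
lemma inv_add {t : ℝ} (ht : 0 < t) : HausdorffMultiplier fun s => (t + s)⁻¹ := by
  have key : ∀ s, 0 < s →
      IntegrableOn (fun x => Real.exp (-(t * x)) * Real.exp (-(x * s))) (Ioi 0) ∧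
      ∫ x in Ioi (0 : ℝ), Real.exp (-(t * x)) * Real.exp (-(x * s)) = (t + s)⁻¹ := by
    intro s hs
    have h : ∀ x : ℝ, Real.exp (-(t * x)) * Real.exp (-(x * s)) = Real.exp (-(t + s) * x) :=
      fun x => by rw [← Real.exp_add]; ring_nf
    simp only [h]
    refine ⟨integrableOn_exp_mul_Ioi (by linarith) 0, ?_⟩
    rw [integral_exp_mul_Ioi (by linarith), mul_zero, Real.exp_zero, neg_div_neg_eq, one_div]
  have hM : HausdorffMultiplier
      fun s => ∫ x in Ioi (0 : ℝ), Real.exp (-(t * x)) * Real.exp (-(x * s)) :=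
    integral ((ae_restrict_mem measurableSet_Ioi).mono fun x hx =>
      (const (Real.exp_nonneg _)).mul (exp_neg_mul (le_of_lt hx))) fun s hs => (key s hs).1
  -- The integral is `(t + s)⁻¹` for `s > 0` only. A constant family converging on `s > 0` transfers
  -- the property, which does not depend on the values at other points.
  exact of_tendsto (l := (atTop : Filter ℕ)) (M := fun _ => _) (.of_forall fun _ => hM)
    fun s hs => by rw [(key s hs).2]; exact tendsto_const_nhds

/-- By the integral representation `s ^ α = κ ∫₀^∞ t ^ α (t⁻¹ - (t + s)⁻¹) dt`, the function
`e^{-τ s ^ α}` is the limit as `N → ∞` of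
`exp (-τ κ ∫₀^N t ^ (α - 1) dt) * exp (τ κ ∫₀^N t ^ α (t + s)⁻¹ dt)`. -/
lemma exp_neg_mul_rpow {α τ : ℝ} (hα : α ∈ Ioo (0 : ℝ) 1) (hτ : 0 ≤ τ) :
    HausdorffMultiplier fun s => Real.exp (-(s ^ α * τ)) := by
  set κ : ℝ := (∫ t in Ioi 0, Real.rpowIntegrand₀₁ α t 1)⁻¹ with hκ
  have hκ0 : 0 ≤ κ := inv_nonneg.2 <| setIntegral_nonneg measurableSet_Ioi fun t ht =>
    Real.rpowIntegrand₀₁_nonneg hα.1 (le_of_lt ht) zero_le_one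
  have h1 : ∀ N : ℝ, IntegrableOn (fun t : ℝ => t ^ (α - 1)) (Ioc 0 N) := fun N => by
    rcases le_total 0 N with h | h
    · exact (intervalIntegrable_iff_integrableOn_Ioc_of_le h).1
        (intervalIntegral.intervalIntegrable_rpow' (by linarith [hα.1]))
    · simp [Ioc_eq_empty_of_le h]
  have h2 : ∀ N s : ℝ, 0 < s → IntegrableOn (fun t : ℝ => t ^ α * (t + s)⁻¹) (Ioc 0 N) := by
    intro N s hs
    have := (h1 N).sub ((Real.integrableOn_rpowIntegrand₀₁_Ioi hα hs.le).mono_set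
      (Ioc_subset_Ioi_self : Ioc 0 N ⊆ _))
    refine this.congr_fun (fun t ht => ?_) measurableSet_Ioc
    have := congrFun (Real.rpowIntegrand₀₁_eq_sub hα.2.ne ht.1) s
    simp only [Pi.sub_apply, this]
    ring
  have h3 : ∀ N : ℝ, HausdorffMultiplier fun s => ∫ t in Ioc 0 N, t ^ α * (t + s)⁻¹ := fun N =>
    integral ((ae_restrict_mem measurableSet_Ioc).mono fun t ht =>
      (const (Real.rpow_nonneg ht.1.le _)).mul (inv_add ht.1)) fun s hs => h2 N s hs
  refine of_tendsto (l := (atTop : Filter ℝ)) (M := fun N s =>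
    Real.exp (-(τ * κ * ∫ t in Ioc 0 N, t ^ (α - 1))) *
      Real.exp (τ * κ * ∫ t in Ioc 0 N, t ^ α * (t + s)⁻¹))
    (.of_forall fun N => (const (Real.exp_nonneg _)).mul
      ((const (mul_nonneg hτ hκ0)).mul (h3 N)).exp) fun s hs => ?_
  have h4 : ∀ N : ℝ, Real.exp (-(τ * κ * ∫ t in Ioc 0 N, t ^ (α - 1))) *
      Real.exp (τ * κ * ∫ t in Ioc 0 N, t ^ α * (t + s)⁻¹) =
      Real.exp (-(τ * κ * ∫ t in Ioc 0 N, Real.rpowIntegrand₀₁ α t s)) := by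
    intro N
    have : ∫ t in Ioc 0 N, Real.rpowIntegrand₀₁ α t s =
        (∫ t in Ioc 0 N, t ^ (α - 1)) - ∫ t in Ioc 0 N, t ^ α * (t + s)⁻¹ := by
      rw [← integral_sub (h1 N) (h2 N s hs)]
      exact setIntegral_congr_fun measurableSet_Ioc fun t ht =>
        congrFun (Real.rpowIntegrand₀₁_eq_sub hα.2.ne ht.1) s
    rw [← Real.exp_add, this, mul_sub, neg_sub, neg_add_eq_sub]
  simp only [h4]
  have h5 : s ^ α * τ = τ * κ * ∫ t in Ioi 0, Real.rpowIntegrand₀₁ α t s := by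
    rw [Real.rpow_eq_const_mul_integral hα hs.le, hκ]
    ring
  rw [h5]
  refine (Real.continuous_exp.tendsto _).comp ((Tendsto.const_mul _ ?_).neg)
  have := intervalIntegral_tendsto_integral_Ioi 0
    (Real.integrableOn_rpowIntegrand₀₁_Ioi hα hs.le) tendsto_id
  refine this.congr' ((eventually_ge_atTop 0).mono fun N hN => ?_)
  rw [id, intervalIntegral.integral_of_le hN]

end HausdorffMultiplier

/-! ### Functions whose Laplace transform is Hausdorff positive -/

lemma exp_neg_mem_Icc {t : ℝ} (ht : 0 ≤ t) : Real.exp (-t) ∈ Icc (0 : ℝ) 1 :=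
  ⟨Real.exp_nonneg _, Real.exp_le_one_iff.2 (by linarith)⟩

lemma integrableOn_polynomial_exp_mul {f : ℝ → ℝ} (hf : IntegrableOn f (Ioi 0)) (p : ℝ[X]) :
    IntegrableOn (fun t => p.eval (Real.exp (-t)) * f t) (Ioi 0) := by
  obtain ⟨C, hC⟩ := (isCompact_Icc (a := (0 : ℝ)) (b := 1)).exists_bound_of_continuousOn
    p.continuous.continuousOn
  refine Integrable.bdd_mul (c := C) hf
    (by exact (p.continuous.comp (by fun_prop)).aestronglyMeasurable) ?_
  exact (ae_restrict_mem measurableSet_Ioi).mono fun t ht => hC _ (exp_neg_mem_Icc (le_of_lt ht))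

/-- A function whose integrals against `p(e^{-t})` are nonnegative for all polynomials `p`
nonnegative on `[0, 1]` is itself nonnegative: indicators are approximated in `L¹(|f|)` by
continuous functions of `e^{-t}`, and these uniformly by polynomials. -/
lemma ae_nonneg_of_integral_polynomial_exp_nonneg {f : ℝ → ℝ} (hf : IntegrableOn f (Ioi 0))
    (h : ∀ p : ℝ[X], (∀ x ∈ Icc (0 : ℝ) 1, 0 ≤ p.eval x) →
      0 ≤ ∫ t in Ioi 0, p.eval (Real.exp (-t)) * f t) :
    0 ≤ᵐ[volume.restrict (Ioi 0)] f := by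
  refine ae_nonneg_of_forall_setIntegral_nonneg hf fun A hA _ => ?_
  set μ := volume.restrict (Ioi (0 : ℝ)) with hμ
  set ν : Measure ℝ := (μ.withDensity fun t => (‖f t‖₊ : ENNReal)).map fun t => Real.exp (-t)
    with hν
  have hexp : Measurable fun t : ℝ => Real.exp (-t) := by fun_prop
  have : IsFiniteMeasure (μ.withDensity fun t => (‖f t‖₊ : ENNReal)) :=
    isFiniteMeasure_withDensity hf.2.ne
  -- `A` is described in the variable `x = e^{-t}`.
  set A' : Set ℝ := (fun x => -Real.log x) ⁻¹' A with hA'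
  have hA'm : MeasurableSet A' := by
    have : Measurable fun x : ℝ => -Real.log x := Real.measurable_log.neg
    exact this hA
  set χ : ℝ → ℝ := A'.indicator fun _ => 1 with hχ
  have hχA : ∀ t, χ (Real.exp (-t)) = A.indicator (fun _ => 1) t := by
    intro t
    have : Real.exp (-t) ∈ A' ↔ t ∈ A := by
      change -Real.log (Real.exp (-t)) ∈ A ↔ _
      rw [Real.log_exp, neg_neg]
    by_cases ht : t ∈ A <;> simp [hχ, this, ht]
  have hχm : Measurable χ := measurable_const.indicator hA'm
  have hint : Integrable χ ν := (integrable_const _).indicator hA'm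
  set K : ℝ := ∫ t, |f t| ∂μ with hK
  have hK0 : 0 ≤ K := integral_nonneg fun _ => abs_nonneg _
  have key : ∀ ε > 0, -(ε * (1 + 2 * K)) ≤ ∫ t in A, f t ∂μ := by
    intro ε hε
    obtain ⟨g, hg, -⟩ := hint.exists_boundedContinuous_integral_sub_le hε
    have hgm : Measurable g := g.continuous.measurable
    obtain ⟨p, hp⟩ := exists_polynomial_near_of_continuousOn 0 1 (fun x => max (g x) 0)
      (by fun_prop) ε hε
    have hp0 : 0 ≤ ∫ t, (p + C ε).eval (Real.exp (-t)) * f t ∂μ := by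
      refine h _ fun x hx => ?_
      have h1 := (abs_lt.1 (hp x hx)).1
      have h2 := le_max_right (g x) 0
      simp only [eval_add, eval_C]
      linarith
    have hg' : ∫ t, |χ (Real.exp (-t)) - g (Real.exp (-t))| * |f t| ∂μ ≤ ε := by
      have : ∫ x, ‖χ x - g x‖ ∂ν =
          ∫ t, |χ (Real.exp (-t)) - g (Real.exp (-t))| * |f t| ∂μ := by
        rw [hν, integral_map hexp.aemeasurable
          (by exact (hχm.sub hgm).norm.aestronglyMeasurable),
          integral_withDensity_eq_integral_smul₀ hf.1.nnnorm.aemeasurable]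
        refine integral_congr_ae (.of_forall fun t => ?_)
        simp [NNReal.smul_def, mul_comm]
      rwa [← this]
    have hi1 : Integrable (fun t => |χ (Real.exp (-t)) - g (Real.exp (-t))| * |f t|) μ := by
      refine Integrable.bdd_mul (c := 1 + ‖g‖) hf.abs
        ((hχm.comp hexp).sub (hgm.comp hexp)).norm.aestronglyMeasurable (.of_forall fun t => ?_)
      rw [Real.norm_eq_abs, abs_abs, ← Real.norm_eq_abs]
      refine (norm_sub_le _ _).trans (add_le_add ?_ (g.norm_coe_le_norm _))
      rw [hχA]
      exact (norm_indicator_le_norm_self _ _).trans (by simp)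
    have hi2 : Integrable (fun t => (p + C ε).eval (Real.exp (-t)) * f t) μ :=
      integrableOn_polynomial_exp_mul hf _
    have hi3 : Integrable (A.indicator f) μ := hf.indicator hA
    have hle : (fun t => -(|χ (Real.exp (-t)) - g (Real.exp (-t))| * |f t|) - 2 * ε * |f t|)
        ≤ᵐ[μ] fun t => A.indicator f t - (p + C ε).eval (Real.exp (-t)) * f t := by
      refine (ae_restrict_mem measurableSet_Ioi).mono fun t ht => ?_
      have hx := hp _ (exp_neg_mem_Icc (le_of_lt ht))
      have e1 : A.indicator f t = χ (Real.exp (-t)) * f t := by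
        rw [hχA]; by_cases h : t ∈ A <;> simp [h]
      have hχ01 : 0 ≤ χ (Real.exp (-t)) := by
        rw [hχA]; exact indicator_nonneg (fun _ _ => zero_le_one) _
      set x := Real.exp (-t)
      have e2 : |χ x - max (g x) 0| ≤ |χ x - g x| := by
        have := abs_max_sub_max_le_abs (χ x) (g x) 0
        rwa [max_eq_left hχ01] at this
      have e3 : |χ x - (p + C ε).eval x| ≤ |χ x - g x| + 2 * ε := by
        simp only [eval_add, eval_C]
        calc |χ x - (p.eval x + ε)|
            = |(χ x - max (g x) 0) - (p.eval x - max (g x) 0) - ε| := by ring_nf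
          _ ≤ |(χ x - max (g x) 0) - (p.eval x - max (g x) 0)| + |ε| := abs_sub _ _
          _ ≤ |χ x - max (g x) 0| + |p.eval x - max (g x) 0| + |ε| := by
            gcongr; exact abs_sub _ _
          _ ≤ |χ x - g x| + 2 * ε := by rw [abs_of_pos hε]; linarith
      have e4 : -|(χ x - (p + C ε).eval x) * f t| ≤ (χ x - (p + C ε).eval x) * f t :=
        neg_abs_le _
      have e5 := mul_le_mul_of_nonneg_right e3 (abs_nonneg (f t))
      rw [abs_mul] at e4
      change -(|χ x - g x| * |f t|) - 2 * ε * |f t| ≤ A.indicator f t - (p + C ε).eval x * f t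
      rw [e1]
      linarith
    have := integral_mono_ae (hi1.neg.sub (hf.abs.const_mul (2 * ε))) (hi3.sub hi2) hle
    have hl : ∫ t, ((-fun t => |χ (Real.exp (-t)) - g (Real.exp (-t))| * |f t|) -
        fun t => 2 * ε * |f t|) t ∂μ =
        -(∫ t, |χ (Real.exp (-t)) - g (Real.exp (-t))| * |f t| ∂μ) - 2 * ε * K := by
      rw [integral_sub' hi1.neg (hf.abs.const_mul (2 * ε)), integral_neg', integral_const_mul]
    have hr := integral_sub' hi3 hi2
    rw [integral_indicator hA] at hr
    have := hl.symm.le.trans (this.trans hr.le)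
    linarith
  refine le_of_forall_pos_sub_le fun ε hε => ?_
  have hc : 0 < 1 + 2 * K := by linarith
  have := key (ε / (1 + 2 * K)) (by positivity)
  rw [div_mul_cancel₀ _ hc.ne'] at this
  linarith

section LaplaceOfHausdorffPositive

variable {k φ : ℝ → ℝ} {σ : ℝ}

/-- The positive functionals in `HausdorffPositive`, evaluated on a Laplace transform. -/
lemma shiftSum_eq_integral
    (hk : ∀ s, σ < s → IntegrableOn (fun t => Real.exp (-(s * t)) * k t) (Ioi 0))
    (hφ : ∀ s, σ < s → ∫ t in Ioi 0, Real.exp (-(s * t)) * k t = φ s) (p : ℝ[X]) {s : ℝ}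
    (hs : σ < s) :
    shiftSum p φ s = ∫ t in Ioi 0, p.eval (Real.exp (-t)) * (Real.exp (-(s * t)) * k t) := by
  have h : ∀ t, p.eval (Real.exp (-t)) * (Real.exp (-(s * t)) * k t) =
      ∑ j ∈ p.support, p.coeff j * (Real.exp (-((s + j) * t)) * k t) := by
    intro t
    rw [eval_eq_sum, Polynomial.sum_def, Finset.sum_mul]
    refine Finset.sum_congr rfl fun j _ => ?_
    rw [← Real.exp_nat_mul, show -((s + j) * t) = j * -t + -(s * t) by ring, Real.exp_add]
    ring
  have hj : ∀ j : ℕ, σ < s + j := fun j => by have : (0 : ℝ) ≤ j := j.cast_nonneg; linarith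
  simp only [h]
  rw [integral_finsetSum _ fun j _ => (hk _ (hj j)).const_mul _]
  simp only [shiftSum, Polynomial.sum_def, integral_const_mul]
  exact Finset.sum_congr rfl fun j _ => by rw [hφ _ (hj j)]

/-- A function whose Laplace transform is Hausdorff positive near infinity is nonnegative. -/
lemma HausdorffPositive.ae_nonneg (hpos : HausdorffPositive φ)
    (hk : ∀ s, σ < s → IntegrableOn (fun t => Real.exp (-(s * t)) * k t) (Ioi 0))
    (hφ : ∀ s, σ < s → ∫ t in Ioi 0, Real.exp (-(s * t)) * k t = φ s) :
    ∀ᵐ t ∂volume.restrict (Ioi (0 : ℝ)), 0 ≤ k t := by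
  have hs : σ < max σ 0 + 1 := by linarith [le_max_left σ 0]
  have hs0 : 0 < max σ 0 + 1 := by linarith [le_max_right σ 0]
  refine (ae_nonneg_of_integral_polynomial_exp_nonneg (hk _ hs) fun p hp => ?_).mono
    fun t ht => nonneg_of_mul_nonneg_right ht (Real.exp_pos _)
  rw [← shiftSum_eq_integral hk hφ p hs]
  exact hpos p hp _ hs0

/-- A bounded Hausdorff positive function that agrees near infinity with the Laplace transform of
`k` forces `k` to be integrable. No analytic continuation is involved: with a fixed natural number
`m > σ`, the polynomials `∑_{i<n} (1 - x ^ m) ^ i` increase to `x ^ (-m)` on `(0, 1]`, and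
positivity at the small point `s` bounds `∫ e^{-(s + m) t} ∑_{i<n} (1 - e^{-mt}) ^ i k(t) dt` by
`φ s`. -/
lemma HausdorffPositive.integrableOn (hpos : HausdorffPositive φ) {B : ℝ}
    (hB : ∀ s, 0 < s → φ s ≤ B)
    (hk : ∀ s, σ < s → IntegrableOn (fun t => Real.exp (-(s * t)) * k t) (Ioi 0))
    (hφ : ∀ s, σ < s → ∫ t in Ioi 0, Real.exp (-(s * t)) * k t = φ s) :
    IntegrableOn k (Ioi 0) := by
  have hk0 := hpos.ae_nonneg hk hφ
  obtain ⟨m, hm⟩ := exists_nat_gt (max σ 0)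
  have hmσ : σ < m := (le_max_left _ _).trans_lt hm
  have hm0 : (0 : ℝ) < m := (le_max_right _ _).trans_lt hm
  let P : ℕ → ℝ[X] := fun n => ∑ i ∈ Finset.range n, (1 - X ^ m) ^ i
  have hP : ∀ n (x : ℝ), x ^ m * (P n).eval x = 1 - (1 - x ^ m) ^ n := by
    intro n x
    have := mul_neg_geom_sum (1 - x ^ m) n
    rw [sub_sub_cancel] at this
    rw [← this]
    simp [P, eval_finsetSum]
  -- The base point `s n` tends to `0` along with `n → ∞`, so that one limit reaches `k` itself.
  let s : ℕ → ℝ := fun n => 1 / ((n : ℝ) + 1)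
  have hs : ∀ n, 0 < s n := fun n => by positivity
  let F : ℕ → ℝ → ℝ := fun n t => (P n).eval (Real.exp (-t)) * (Real.exp (-((s n + m) * t)) * k t)
  have hsm : ∀ n, σ < s n + m := fun n => by linarith [hs n]
  have hFint : ∀ n, IntegrableOn (F n) (Ioi 0) := fun n =>
    integrableOn_polynomial_exp_mul (hk _ (hsm n)) _
  have hFeq : ∀ n t, F n t = Real.exp (-(s n * t)) * (1 - (1 - Real.exp (-(m * t))) ^ n) * k t := by
    intro n t
    have := hP n (Real.exp (-t))
    rw [← Real.exp_nat_mul, mul_neg] at this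
    rw [← this]
    simp only [F]
    rw [show -((s n + m) * t) = -(s n * t) + -(m * t) by ring, Real.exp_add]
    ring
  have hx : ∀ {t : ℝ}, 0 < t → 0 ≤ 1 - Real.exp (-(m * t)) ∧ 1 - Real.exp (-(m * t)) < 1 :=
    fun {t} ht => ⟨sub_nonneg.2 (Real.exp_le_one_iff.2 (by nlinarith)),
      by linarith [Real.exp_pos (-(m * t))]⟩
  have hF0 : ∀ n, 0 ≤ᵐ[volume.restrict (Ioi (0 : ℝ))] F n := by
    intro n
    filter_upwards [hk0, ae_restrict_mem measurableSet_Ioi] with t ht ht0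
    rw [Pi.zero_apply, hFeq]
    exact mul_nonneg (mul_nonneg (Real.exp_nonneg _)
      (sub_nonneg.2 (pow_le_one₀ (hx ht0).1 (hx ht0).2.le))) ht
  have hFB : ∀ n, ∫ t in Ioi 0, F n t ≤ B := by
    intro n
    rw [← shiftSum_eq_integral hk hφ (P n) (hsm n)]
    have h1 : 0 ≤ shiftSum (1 - P n * X ^ m) φ (s n) := by
      refine hpos _ (fun x hx => ?_) _ (hs n)
      have := hP n x
      simp only [eval_sub, eval_one, eval_mul, eval_pow, eval_X]
      rw [mul_comm, this, sub_sub_cancel]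
      exact pow_nonneg (sub_nonneg.2 (pow_le_one₀ hx.1 hx.2)) _
    have h2 : shiftSum (1 - P n * X ^ m) φ (s n) = φ (s n) - shiftSum (P n) φ (s n + m) := by
      set N := (P n).natDegree + (1 - P n * X ^ m).natDegree + 1 with hN
      rw [shiftSum_eq_sum_range (n := m + N) (by omega), shiftSum_eq_sum_range (n := N) (by omega)]
      simp only [coeff_sub, sub_mul, Finset.sum_sub_distrib]
      congr 1
      · rw [Finset.sum_eq_single 0]
        · simp
        · intro j _ hj
          simp [coeff_one, hj]
        · intro h; simp [hN] at h
      · rw [Finset.sum_range_add, Finset.sum_eq_zero, zero_add]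
        · refine Finset.sum_congr rfl fun j _ => ?_
          rw [add_comm m j, coeff_mul_X_pow]
          push_cast
          ring_nf
        · intro j hj
          rw [coeff_mul_X_pow', if_neg (by simpa using hj), zero_mul]
    linarith [hB _ (hs n)]
  have hlim : ∀ᵐ t ∂volume.restrict (Ioi (0 : ℝ)),
      Tendsto (fun n => F n t) atTop (𝓝 (k t)) := by
    filter_upwards [ae_restrict_mem measurableSet_Ioi] with t ht
    simp only [hFeq]
    have h1 : Tendsto (fun n => Real.exp (-(s n * t))) atTop (𝓝 1) := by
      have := ((tendsto_one_div_add_atTop_nhds_zero_nat (𝕜 := ℝ)).mul_const t).neg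
      rw [zero_mul, neg_zero] at this
      simpa [s, Function.comp_def] using (Real.continuous_exp.tendsto 0).comp this
    have h2 := (tendsto_pow_atTop_nhds_zero_of_lt_one (hx ht).1 (hx ht).2).const_sub 1
    simpa using (h1.mul h2).mul_const (k t)
  refine integrable_of_tendsto hlim (fun n => (hFint n).1) (ne_top_of_le_ne_top
    (b := ENNReal.ofReal B) ENNReal.ofReal_ne_top ?_)
  refine (liminf_le_liminf (.of_forall fun n => ?_)).trans_eq (liminf_const (ENNReal.ofReal B))
  rw [← ofReal_integral_norm_eq_lintegral_enorm (hFint n)]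
  refine ENNReal.ofReal_le_ofReal (le_trans (integral_congr_ae ?_).le (hFB n))
  exact (hF0 n).mono fun t ht => Real.norm_of_nonneg ht

end LaplaceOfHausdorffPositive

/-! ### Laplace transforms, stability and rational transfer functions -/

section LaplaceTransform

variable {k : ℝ → ℝ}

lemma norm_laplace_integrand (k : ℝ → ℝ) (s : ℂ) (t : ℝ) :
    ‖Complex.exp (-s * t) * (k t : ℂ)‖ = Real.exp (-(s.re * t)) * |k t| := by
  rw [norm_mul, Complex.norm_exp, Complex.norm_real, Real.norm_eq_abs]
  simp

lemma laplace_integrand_ofReal (k : ℝ → ℝ) (s t : ℝ) :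
    Complex.exp (-(s : ℂ) * t) * (k t : ℂ) = ((Real.exp (-(s * t)) * k t : ℝ) : ℂ) := by
  push_cast
  rw [neg_mul]

lemma integrableOn_exp_mul_of_nonneg (hk : IntegrableOn k (Ioi 0)) {s : ℝ} (hs : 0 ≤ s) :
    IntegrableOn (fun t => Real.exp (-(s * t)) * k t) (Ioi 0) := by
  refine Integrable.bdd_mul (c := 1) hk (by fun_prop) ?_
  filter_upwards [ae_restrict_mem measurableSet_Ioi] with t (ht : 0 < t)
  rw [Real.norm_eq_abs, Real.abs_exp]
  exact Real.exp_le_one_iff.2 (neg_nonpos.2 (mul_nonneg hs ht.le))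

lemma differentiableOn_laplace (hk : IntegrableOn k (Ioi 0)) :
    DifferentiableOn ℂ (fun s : ℂ => ∫ t in Ioi (0 : ℝ), Complex.exp (-s * t) * (k t : ℂ))
      {s | 0 < s.re} := by
  intro s₀ (hs₀ : 0 < s₀.re)
  set r := s₀.re / 2 with hr
  have hr0 : 0 < r := by positivity
  have hkm : AEStronglyMeasurable (fun t => (k t : ℂ)) (volume.restrict (Ioi (0 : ℝ))) :=
    Complex.continuous_ofReal.comp_aestronglyMeasurable hk.1
  have hmeas : ∀ s : ℂ, AEStronglyMeasurable (fun t : ℝ => Complex.exp (-s * t) * (k t : ℂ))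
      (volume.restrict (Ioi (0 : ℝ))) := fun s =>
    (by fun_prop : Continuous fun t : ℝ => Complex.exp (-s * t)).aestronglyMeasurable.mul hkm
  have hopen : {s : ℂ | r < s.re} ∈ 𝓝 s₀ :=
    (isOpen_lt continuous_const Complex.continuous_re).mem_nhds (by change r < s₀.re; linarith)
  refine ((hasDerivAt_integral_of_dominated_loc_of_deriv_le
    (F' := fun s t => Complex.exp (-s * t) * (-1 * (t : ℂ)) * (k t : ℂ))
    (bound := fun t => r⁻¹ * |k t|) hopen (.of_forall hmeas) ?_ ?_ ?_
    (hk.abs.const_mul _) ?_).2.differentiableAt).differentiableWithinAt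
  · refine (integrable_norm_iff (hmeas s₀)).1 ?_
    simp only [norm_laplace_integrand]
    exact integrableOn_exp_mul_of_nonneg hk.abs hs₀.le
  · exact (by fun_prop : Continuous fun t : ℝ =>
      Complex.exp (-s₀ * t) * (-1 * (t : ℂ))).aestronglyMeasurable.mul hkm
  · filter_upwards [ae_restrict_mem measurableSet_Ioi] with t (ht : 0 < t) s (hs : r < s.re)
    have h1 : r * t * Real.exp (-(r * t)) ≤ 1 := by
      rw [Real.exp_neg, ← div_eq_mul_inv, div_le_one (Real.exp_pos _)]
      linarith [Real.add_one_le_exp (r * t)]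
    have h2 : Real.exp (-(s.re * t)) ≤ Real.exp (-(r * t)) :=
      Real.exp_le_exp.2 (neg_le_neg (mul_le_mul_of_nonneg_right hs.le ht.le))
    calc ‖Complex.exp (-s * t) * (-1 * (t : ℂ)) * (k t : ℂ)‖
        = t * ‖Complex.exp (-s * t) * (k t : ℂ)‖ := by
          simp only [norm_mul, norm_neg, norm_one, Complex.norm_real, Real.norm_of_nonneg ht.le]
          ring
      _ ≤ t * (Real.exp (-(r * t)) * |k t|) := by
          rw [norm_laplace_integrand]; gcongr
      _ = r⁻¹ * (r * t * Real.exp (-(r * t))) * |k t| := by field_simp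
      _ ≤ r⁻¹ * 1 * |k t| := by gcongr
      _ = r⁻¹ * |k t| := by rw [mul_one]
  · refine .of_forall fun t s _ => ?_
    exact (((hasDerivAt_id s).neg.mul_const (t : ℂ)).cexp).mul_const _

lemma tendsto_laplace_nhdsGT_zero (hk : IntegrableOn k (Ioi 0)) :
    Tendsto (fun s : ℝ => ∫ t in Ioi (0 : ℝ), Real.exp (-(s * t)) * k t) (𝓝[>] 0)
      (𝓝 (∫ t in Ioi (0 : ℝ), k t)) := by
  refine tendsto_integral_filter_of_dominated_convergence (fun t => |k t|) ?_ ?_ hk.abs ?_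
  · filter_upwards [self_mem_nhdsWithin] with s hs
    exact (integrableOn_exp_mul_of_nonneg hk (le_of_lt hs)).1
  · filter_upwards [self_mem_nhdsWithin] with s (hs : 0 < s)
    filter_upwards [ae_restrict_mem measurableSet_Ioi] with t (ht : 0 < t)
    rw [norm_mul, Real.norm_eq_abs, Real.abs_exp]
    exact mul_le_of_le_one_left (abs_nonneg _) (Real.exp_le_one_iff.2 (by nlinarith))
  · refine .of_forall fun t => ?_
    have : Continuous fun s : ℝ => Real.exp (-(s * t)) * k t := by fun_prop
    simpa using (this.tendsto 0).mono_left nhdsWithin_le_nhds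

lemma tendsto_laplace_atTop {s₀ : ℝ}
    (hk : IntegrableOn (fun t => Real.exp (-(s₀ * t)) * k t) (Ioi 0)) :
    Tendsto (fun s : ℝ => ∫ t in Ioi (0 : ℝ), Real.exp (-(s * t)) * k t) atTop (𝓝 0) := by
  have heq : ∀ s t, Real.exp (-(s * t)) * k t =
      Real.exp (-((s - s₀) * t)) * (Real.exp (-(s₀ * t)) * k t) := by
    intro s t
    rw [← mul_assoc, ← Real.exp_add]
    ring_nf
  suffices h : Tendsto (fun s : ℝ => ∫ t in Ioi (0 : ℝ), Real.exp (-(s * t)) * k t) atTop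
      (𝓝 (∫ _ in Ioi (0 : ℝ), (0 : ℝ))) by simpa using h
  refine tendsto_integral_filter_of_dominated_convergence
    (fun t => ‖Real.exp (-(s₀ * t)) * k t‖) ?_ ?_ hk.norm ?_
  · filter_upwards [eventually_ge_atTop s₀] with s hs
    simp only [heq s]
    exact (integrableOn_exp_mul_of_nonneg hk (sub_nonneg.2 hs)).1
  · filter_upwards [eventually_ge_atTop s₀] with s hs
    filter_upwards [ae_restrict_mem measurableSet_Ioi] with t (ht : 0 < t)
    rw [heq, norm_mul, Real.norm_eq_abs (Real.exp _), Real.abs_exp]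
    exact mul_le_of_le_one_left (norm_nonneg _) (Real.exp_le_one_iff.2 (by nlinarith))
  · filter_upwards [ae_restrict_mem measurableSet_Ioi] with t (ht : 0 < t)
    have : Tendsto (fun s : ℝ => Real.exp (-(s * t))) atTop (𝓝 0) :=
      Real.tendsto_exp_neg_atTop_nhds_zero.comp (tendsto_id.atTop_mul_const ht)
    simpa using this.mul_const (k t)

/-- Uniqueness of analytic continuation from a right half-plane to `Re s > 0`. -/
lemma eqOn_re_pos_of_eq_of_lt_re {f g : ℂ → ℂ} (hf : DifferentiableOn ℂ f {s | 0 < s.re})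
    (hg : DifferentiableOn ℂ g {s | 0 < s.re}) {σ : ℝ} (h : ∀ s : ℂ, σ < s.re → f s = g s) :
    EqOn f g {s | 0 < s.re} := by
  have hU : IsOpen {s : ℂ | 0 < s.re} := isOpen_lt continuous_const Complex.continuous_re
  have h0 : (max σ 0 + 1 : ℝ) > 0 := by linarith [le_max_right σ 0]
  have h1 : σ < (max σ 0 + 1 : ℝ) := by linarith [le_max_left σ 0]
  refine (hf.analyticOnNhd hU).eqOn_of_preconnected_of_eventuallyEq (hg.analyticOnNhd hU)
    (convex_halfSpace_re_gt 0).isPreconnected (z₀ := ((max σ 0 + 1 : ℝ) : ℂ))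
    (by simpa using h0) ?_
  filter_upwards [(isOpen_lt continuous_const Complex.continuous_re).mem_nhds
    (by simpa using h1 : ((max σ 0 + 1 : ℝ) : ℂ) ∈ {s : ℂ | σ < s.re})] with s hs using h s hs

end LaplaceTransform

namespace ImpulseResponse

variable {h : ImpulseResponse} {H : ℂ → ℂ}

/-- Restriction of the defining relation of an impulse response to the real axis. -/
lemma IsResponseOf.real (hh : h.IsResponseOf H) : ∃ σ : ℝ, ∀ s : ℝ, σ < s →
    IntegrableOn (fun t => Real.exp (-(s * t)) * h.kernel t) (Ioi 0) ∧
    ((h.direct + ∫ t in Ioi (0 : ℝ), Real.exp (-(s * t)) * h.kernel t : ℝ) : ℂ) = H s := by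
  obtain ⟨σ, hσ⟩ := hh
  refine ⟨σ, fun s hs => ?_⟩
  obtain ⟨h1, h2⟩ := hσ s (by simpa using hs)
  simp only [laplace_integrand_ofReal] at h1 h2
  have h3 : IntegrableOn (fun t => Real.exp (-(s * t)) * h.kernel t) (Ioi 0) := by
    have := Integrable.re h1
    simpa only [IntegrableOn, Complex.ofReal_re, RCLike.re_eq_complex_re] using this
  refine ⟨h3, ?_⟩
  rw [integral_complex_ofReal] at h2
  rw [← h2]
  push_cast
  rfl

lemma Nonneg.ae_Ioi (hh : h.Nonneg) : ∀ᵐ t ∂volume.restrict (Ioi (0 : ℝ)), 0 ≤ h.kernel t :=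
  ae_restrict_of_ae_restrict_of_subset Ioi_subset_Ici_self hh.2

/-- A nonnegative BIBO-stable impulse response is integrable: its response to the unit step is
`t ↦ c + ∫₀ᵗ k`, which is monotone, so essential boundedness bounds all the integrals. -/
lemma BIBOStable.integrableOn (hh : h.BIBOStable) (hH : h.IsResponseOf H) (hn : h.Nonneg) :
    IntegrableOn h.kernel (Ioi 0) := by
  obtain ⟨σ, hσ⟩ := hH.real
  have hloc : ∀ T : ℝ, IntegrableOn h.kernel (Ioc 0 T) := by
    intro T
    have h1 := ((hσ (σ + 1) (by linarith)).1.mono_set (Ioc_subset_Ioi_self : Ioc 0 T ⊆ _))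
    have h2 := (integrableOn_Icc_iff_integrableOn_Ioc (μ := volume)).2 h1
    have h3 := (h2.continuousOn_mul (g := fun t => Real.exp ((σ + 1) * t))
      (by fun_prop) isCompact_Icc).mono_set (Ioc_subset_Icc_self : Ioc 0 T ⊆ _)
    refine h3.congr_fun (fun t _ => ?_) measurableSet_Ioc
    simp only
    rw [← mul_assoc, ← Real.exp_add, add_neg_cancel, Real.exp_zero, one_mul]
  obtain ⟨M, hM⟩ : ∃ M : ℝ, ∀ᵐ t ∂volume.restrict (Ici (0 : ℝ)),
      ‖h.output (fun _ => 1) t‖ ≤ M := by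
    have h1 := hh (fun _ => 1) (memLp_top_const 1)
    refine ⟨(eLpNormEssSup (h.output fun _ => 1) (volume.restrict (Ici 0))).toReal,
      (ae_le_eLpNormEssSup (f := h.output fun _ => 1)).mono fun t ht => ?_⟩
    have h2 := h1.2
    rw [eLpNorm_exponent_top] at h2
    simpa using ENNReal.toReal_mono h2.ne ht
  refine integrableOn_Ioi_of_intervalIntegral_norm_bounded (b := id) (l := atTop)
    (M + |h.direct|) 0 hloc tendsto_id ?_
  filter_upwards [eventually_ge_atTop 0] with T hT
  -- the bound on the output holds at almost every time, in particular at some time after `T`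
  obtain ⟨T', hT', hMT⟩ : ∃ T' > T, ‖h.output (fun _ => 1) T'‖ ≤ M := by
    have h1 : ∀ᵐ t ∂volume.restrict (Ioi T), ‖h.output (fun _ => 1) t‖ ≤ M :=
      ae_restrict_of_ae_restrict_of_subset (fun t ht => hT.trans (le_of_lt ht)) hM
    have : (ae (volume.restrict (Ioi T))).NeBot := by
      rw [ae_neBot, Ne, Measure.restrict_eq_zero]
      simp
    obtain ⟨t, ht, ht'⟩ := ((ae_restrict_mem measurableSet_Ioi).and h1).exists
    exact ⟨t, ht, ht'⟩
  have hT'0 : 0 ≤ T' := hT.trans (le_of_lt hT')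
  have hle : ∫ t in Ioc 0 T, ‖h.kernel t‖ ≤ ∫ t in Ioc 0 T', ‖h.kernel t‖ :=
    setIntegral_mono_set (hloc T').norm (.of_forall fun _ => norm_nonneg _)
      (Ioc_subset_Ioc_right (le_of_lt hT')).eventuallyLE
  have heq : ∫ t in Ioc 0 T', ‖h.kernel t‖ = ∫ t in Ioc 0 T', h.kernel t :=
    integral_congr_ae <| (ae_restrict_of_ae_restrict_of_subset Ioc_subset_Ioi_self hn.ae_Ioi).mono
      fun t ht => Real.norm_of_nonneg ht
  rw [id, intervalIntegral.integral_of_le hT]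
  simp only [output, mul_one, intervalIntegral.integral_of_le hT'0, Real.norm_eq_abs] at hMT
  have := (abs_le.1 hMT).2
  have := neg_abs_le h.direct
  linarith

end ImpulseResponse

section RationalTransferFunction

variable {Z : RatFunc ℝ} {z : ImpulseResponse}

lemma transferFunction_eq_div (Z : RatFunc ℝ) (s : ℂ) :
    transferFunction Z s = aeval s Z.num / aeval s Z.denom := rfl

/-- The relation `(c + ∫ e^{-st} k) * denom = num`, valid by definition near infinity and away from
the zeros of the denominator, persists on the whole open right half-plane. -/
lemma laplace_mul_denom (hz : z.IsResponseOf (transferFunction Z))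
    (hk : IntegrableOn z.kernel (Ioi 0)) {s : ℂ} (hs : 0 < s.re) :
    (z.direct + ∫ t in Ioi (0 : ℝ), Complex.exp (-s * t) * (z.kernel t : ℂ)) * aeval s Z.denom =
      aeval s Z.num := by
  obtain ⟨σ, hσ⟩ := hz
  -- beyond `σ'` the denominator has no zeros, so `transferFunction` takes no junk value there
  obtain ⟨σ', h1, h2⟩ : ∃ σ', σ ≤ σ' ∧ ∀ s : ℂ, σ' < s.re → aeval s Z.denom ≠ 0 := by
    obtain ⟨R, hR⟩ := ((Z.denom.aroots ℂ).toFinset.image Complex.re).bddAbove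
    refine ⟨max σ R, le_max_left _ _, fun s hs h0 => ?_⟩
    have : s.re ≤ R := hR <| by
      rw [Finset.coe_image]
      exact ⟨s, by simp [Z.denom_ne_zero, h0], rfl⟩
    linarith [le_max_right σ R]
  refine eqOn_re_pos_of_eq_of_lt_re (σ := σ')
    (f := fun s => (z.direct + ∫ t in Ioi (0 : ℝ), Complex.exp (-s * t) * (z.kernel t : ℂ)) *
      aeval s Z.denom) (g := fun s => aeval s Z.num)
    (((differentiableOn_const _).add (differentiableOn_laplace hk)).mul
      (Polynomial.differentiable_aeval _).differentiableOn)
    (Polynomial.differentiable_aeval _).differentiableOn (fun s hs => ?_) hs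
  rw [(hσ s (h1.trans_lt hs)).2, transferFunction_eq_div, div_mul_cancel₀ _ (h2 s hs)]

/-- By coprimality the denominator has no zero in the right half-plane, so the division by it in
`transferFunction` is genuine there. -/
lemma transferFunction_eq_laplace (hz : z.IsResponseOf (transferFunction Z))
    (hk : IntegrableOn z.kernel (Ioi 0)) {s : ℂ} (hs : 0 < s.re) :
    transferFunction Z s =
      z.direct + ∫ t in Ioi (0 : ℝ), Complex.exp (-s * t) * (z.kernel t : ℂ) := by
  have h := laplace_mul_denom hz hk hs
  have h0 : aeval s Z.denom ≠ 0 := by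
    intro h0
    obtain ⟨a, b, hab⟩ := Z.isCoprime_num_denom
    have := congrArg (aeval s) hab
    rw [h0, mul_zero] at h
    simp [h0, ← h] at this
  rw [transferFunction_eq_div, ← h, mul_div_cancel_right₀ _ h0]

lemma laplace_mul_denom_real (hz : z.IsResponseOf (transferFunction Z))
    (hk : IntegrableOn z.kernel (Ioi 0)) {s : ℝ} (hs : 0 < s) :
    (z.direct + ∫ t in Ioi (0 : ℝ), Real.exp (-(s * t)) * z.kernel t) * Z.denom.eval s =
      Z.num.eval s := by
  have h := laplace_mul_denom hz hk (s := s) (by simpa using hs)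
  simp only [laplace_integrand_ofReal, integral_complex_ofReal] at h
  have e : ∀ p : ℝ[X], aeval (s : ℂ) p = ((p.eval s : ℝ) : ℂ) := fun p =>
    aeval_algebraMap_apply_eq_algebraMap_eval s p
  rw [e, e] at h
  exact_mod_cast h

/-- Letting `s → 0⁺` in `(c + ∫ e^{-st} k) * denom = num`: a pole at `0` would be a common zero of
`num` and `denom`. -/
lemma eval_zero_of_integrable (hz : z.IsResponseOf (transferFunction Z))
    (hk : IntegrableOn z.kernel (Ioi 0)) :
    Z.denom.eval 0 ≠ 0 ∧
      Z.eval (RingHom.id ℝ) 0 = z.direct + ∫ t in Ioi (0 : ℝ), z.kernel t := by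
  have hlim : (z.direct + ∫ t in Ioi (0 : ℝ), z.kernel t) * Z.denom.eval 0 = Z.num.eval 0 := by
    have hp : ∀ p : ℝ[X], Tendsto (fun s => p.eval s) (𝓝[>] 0) (𝓝 (p.eval 0)) := fun p =>
      (p.continuous.tendsto 0).mono_left nhdsWithin_le_nhds
    refine tendsto_nhds_unique (((tendsto_laplace_nhdsGT_zero hk).const_add _).mul (hp _))
      ((hp Z.num).congr' ?_)
    filter_upwards [self_mem_nhdsWithin] with s hs using (laplace_mul_denom_real hz hk hs).symm
  have h0 : Z.denom.eval 0 ≠ 0 := by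
    intro h0
    obtain ⟨a, b, hab⟩ := Z.isCoprime_num_denom
    have := congrArg (eval 0) hab
    rw [h0, mul_zero] at hlim
    simp [h0, ← hlim] at this
  refine ⟨h0, ?_⟩
  change Z.num.eval 0 / Z.denom.eval 0 = _
  rw [← hlim, mul_div_cancel_right₀ _ h0]

/-- A transfer function with an integrable impulse response is proper, being bounded at
infinity. -/
lemma natDegree_num_le_natDegree_denom (hz : z.IsResponseOf (transferFunction Z))
    (hk : IntegrableOn z.kernel (Ioi 0)) : Z.num.natDegree ≤ Z.denom.natDegree := by
  by_contra! hlt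
  have h1 := Polynomial.abs_div_tendsto_atTop_atTop_of_degree_gt Z.num Z.denom
    (degree_lt_degree hlt) Z.denom_ne_zero
  have h2 := ((tendsto_laplace_atTop (s₀ := 0) (k := z.kernel)
    (by simpa using hk)).const_add z.direct).abs
  refine not_tendsto_nhds_of_tendsto_atTop h1 _ (h2.congr' ?_)
  filter_upwards [eventually_gt_atTop 0,
    Polynomial.eventually_atTop_not_isRoot _ Z.denom_ne_zero] with s hs hroot
  rw [← laplace_mul_denom_real hz hk hs, mul_div_cancel_right₀ _ hroot]

end RationalTransferFunction

/-! ### Series in fractional powers and their impulse responses -/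

/-- As `differentiableOn_laplace`, for kernels that become integrable only after damping by
`e^{-st}`: near `s₀` the transform is that of the damped kernel, shifted. -/
lemma differentiableOn_laplace_of_forall {k : ℝ → ℝ}
    (hk : ∀ s, 0 < s → IntegrableOn (fun t => Real.exp (-(s * t)) * k t) (Ioi 0)) :
    DifferentiableOn ℂ (fun s : ℂ => ∫ t in Ioi (0 : ℝ), Complex.exp (-s * t) * (k t : ℂ))
      {s | 0 < s.re} := by
  intro s₀ (hs₀ : 0 < s₀.re)
  set r := s₀.re / 2 with hr
  have hr0 : 0 < r := by positivity
  have h1 := differentiableOn_laplace (hk r hr0)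
  have hopen : IsOpen {s : ℂ | 0 < s.re} := isOpen_lt continuous_const Complex.continuous_re
  have h2 : DifferentiableAt ℂ (fun s : ℂ => ∫ t in Ioi (0 : ℝ),
      Complex.exp (-s * t) * ((Real.exp (-(r * t)) * k t : ℝ) : ℂ)) (s₀ - r) :=
    (h1 _ (by simp; linarith)).differentiableAt (hopen.mem_nhds (by simp; linarith))
  have h3 : DifferentiableAt ℂ (fun s : ℂ => s - (r : ℂ)) s₀ := by fun_prop
  refine (h2.comp s₀ h3).differentiableWithinAt.congr_of_eventuallyEq ?_ ?_ <;>
  [refine .of_forall fun s => ?_; skip] <;>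
  · refine integral_congr_ae (.of_forall fun t => ?_)
    simp only
    rw [← laplace_integrand_ofReal, ← mul_assoc, ← Complex.exp_add]
    ring_nf

section PowerKernel

variable {a : ℝ}

lemma integrableOn_exp_mul_rpow (ha : 0 < a) {s : ℝ} (hs : 0 < s) :
    IntegrableOn (fun t : ℝ => Real.exp (-(s * t)) * t ^ (a - 1)) (Ioi 0) := by
  have := integrableOn_rpow_mul_exp_neg_mul_rpow (s := a - 1) (by linarith) one_pos hs
  refine this.congr_fun (fun t _ => ?_) measurableSet_Ioi
  simp only [Real.rpow_one, neg_mul]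
  rw [mul_comm]

/-- The Laplace transform of `t ^ (a - 1)` at complex points, by continuation from the real axis. -/
lemma laplace_rpow (ha : 0 < a) {s : ℂ} (hs : 0 < s.re) :
    ∫ t in Ioi (0 : ℝ), Complex.exp (-s * t) * ((t ^ (a - 1) : ℝ) : ℂ) =
      (s ^ (a : ℂ))⁻¹ * Real.Gamma a := by
  have hU : IsOpen {s : ℂ | 0 < s.re} := isOpen_lt continuous_const Complex.continuous_re
  have hf := differentiableOn_laplace_of_forall (k := fun t => t ^ (a - 1))
    fun s hs => integrableOn_exp_mul_rpow ha hs
  have hg : DifferentiableOn ℂ (fun s : ℂ => (s ^ (a : ℂ))⁻¹ * Real.Gamma a) {s | 0 < s.re} := by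
    intro s hs
    have hs0 : s ≠ 0 := by rintro rfl; simp at hs
    have hd : DifferentiableAt ℂ (fun s : ℂ => s ^ (a : ℂ)) s :=
      differentiableAt_id.cpow_const (Or.inl hs)
    exact ((hd.inv (by simp [Complex.cpow_eq_zero_iff, hs0])).mul_const _).differentiableWithinAt
  refine (hf.analyticOnNhd hU).eqOn_of_preconnected_of_frequently_eq (hg.analyticOnNhd hU)
    (convex_halfSpace_re_gt 0).isPreconnected (z₀ := 1) (by simp) ?_ hs
  have ht : Tendsto (fun x : ℝ => (x : ℂ)) (𝓝[>] 1) (𝓝[≠] 1) := by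
    refine tendsto_nhdsWithin_iff.2 ⟨?_, ?_⟩
    · simpa using (Complex.continuous_ofReal.tendsto 1).mono_left nhdsWithin_le_nhds
    · filter_upwards [self_mem_nhdsWithin] with x (hx : 1 < x)
      simpa using hx.ne'
  refine ht.frequently (Eventually.frequently ?_)
  filter_upwards [self_mem_nhdsWithin] with x (hx : 1 < x)
  have hx0 : 0 < x := one_pos.trans hx
  rw [integral_congr_ae (.of_forall (laplace_integrand_ofReal (fun t => t ^ (a - 1)) x)),
    integral_complex_ofReal, ← Complex.ofReal_cpow hx0.le, ← Complex.ofReal_inv, ← Complex.ofReal_mul]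
  have := Real.integral_rpow_mul_exp_neg_mul_Ioi ha hx0
  rw [one_div, Real.inv_rpow hx0.le] at this
  rw [← this]
  congr 1
  exact integral_congr_ae (.of_forall fun t => mul_comm _ _)

end PowerKernel

lemma integrable_tsum_of_summable_integral_norm {β : Type*} [MeasurableSpace β] {μ : Measure β}
    {F : ℕ → β → ℂ} (hF : ∀ n, Integrable (F n) μ) (hsum : Summable fun n => ∫ t, ‖F n t‖ ∂μ) :
    Integrable (fun t => ∑' n, F n t) μ := by
  have hfin : ∫⁻ t, ∑' n, ‖F n t‖ₑ ∂μ < ⊤ := by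
    rw [lintegral_tsum fun n => (hF n).1.enorm]
    simp only [← ofReal_integral_norm_eq_lintegral_enorm (hF _)]
    exact hsum.tsum_ofReal_lt_top
  have hae : ∀ᵐ t ∂μ, Summable fun n => F n t := by
    filter_upwards [ae_lt_top' (.tsum fun n => (hF n).1.enorm) hfin.ne] with t ht
    exact Summable.of_nnnorm (ENNReal.tsum_coe_ne_top_iff_summable.1 ht.ne)
  refine ⟨aestronglyMeasurable_of_tendsto_ae atTop
    (f := fun n t => ∑ i ∈ Finset.range n, F i t)
    (fun n => Finset.aestronglyMeasurable_fun_sum _ fun i _ => (hF i).1)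
    (hae.mono fun t ht => ht.hasSum.tendsto_sum_nat), ?_⟩
  exact (lintegral_mono fun t => enorm_tsum_le_tsum_enorm).trans_lt hfin

/-- Term by term inversion of a power series in `s ^ (-α)`: since `s ^ (-αn)` is the Laplace
transform of `t ^ (αn - 1) / Γ(αn)`, the impulse response of `∑ₙ bₙ s ^ (-αn)` is
`b₀ δ + ∑ₙ bₙ₊₁ t ^ (α(n+1) - 1) / Γ(α(n+1))`. -/
lemma exists_isResponseOf_of_hasSum {b : ℕ → ℝ} {R α : ℝ} {H : ℂ → ℂ} (hR : 0 < R) (hα : 0 < α)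
    (hb : Summable fun n => |b n| * R ^ n)
    (hH : ∀ s : ℂ, 0 < s.re → ‖(s ^ (α : ℂ))⁻¹‖ ≤ R →
      HasSum (fun n => (b n : ℂ) * (s ^ (α : ℂ))⁻¹ ^ n) (H s)) :
    ∃ w : ImpulseResponse, w.IsResponseOf H := by
  let c : ℕ → ℝ := fun n => b (n + 1) / Real.Gamma (α * (n + 1 : ℕ))
  let e : ℕ → ℝ := fun n => α * (n + 1 : ℕ)
  have he : ∀ n, 0 < e n := fun n => by positivity
  let f : ℕ → ℝ → ℝ := fun n t => c n * t ^ (e n - 1)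
  -- `Re s > R ^ (-1 / α)` ensures `‖s ^ (-α)‖ ≤ R`.
  refine ⟨⟨b 0, fun t => ∑' n, f n t⟩, R ^ (-α⁻¹), fun s hs => ?_⟩
  have hσ : 0 < R ^ (-α⁻¹) := Real.rpow_pos_of_pos hR _
  have hs0 : 0 < s.re := hσ.trans hs
  have hsR : (s.re ^ α)⁻¹ ≤ R := by
    refine inv_le_of_inv_le₀ hR ?_
    calc R⁻¹ = (R ^ (-α⁻¹)) ^ α := by
          rw [← Real.rpow_mul hR.le, neg_mul, inv_mul_cancel₀ hα.ne', Real.rpow_neg_one]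
      _ ≤ s.re ^ α := Real.rpow_le_rpow hσ.le hs.le hα.le
  have hsum := hH s hs0 (by
    rw [norm_inv, Complex.norm_cpow_real]
    refine le_trans ?_ hsR
    gcongr
    exact Complex.re_le_norm s)
  let F : ℕ → ℝ → ℂ := fun n t => Complex.exp (-s * t) * (f n t : ℂ)
  have hFc : ∀ n t, F n t = (c n : ℂ) * (Complex.exp (-s * t) * ((t ^ (e n - 1) : ℝ) : ℂ)) := by
    intro n t
    simp only [F, f]
    push_cast
    ring
  have hpow : ∀ (x : ℂ) (n : ℕ), x ^ ((e n : ℝ) : ℂ) = (x ^ (α : ℂ)) ^ (n + 1) := by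
    intro x n
    rw [← Complex.cpow_mul_nat]
    simp [e]
  have hFint : ∀ n, Integrable (F n) (volume.restrict (Ioi 0)) := by
    intro n
    have hm : AEStronglyMeasurable (fun t : ℝ => Complex.exp (-s * t) * ((t ^ (e n - 1) : ℝ) : ℂ))
        (volume.restrict (Ioi 0)) := by
      refine Measurable.aestronglyMeasurable ?_
      fun_prop
    simp only [F, hFc]
    refine Integrable.const_mul ((integrable_norm_iff hm).1 ?_) _
    refine (integrableOn_exp_mul_rpow (he n) hs0).congr_fun (fun t (ht : 0 < t) => ?_)
      measurableSet_Ioi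
    simp only
    rw [norm_laplace_integrand (fun t => t ^ (e n - 1)), abs_of_nonneg (Real.rpow_nonneg ht.le _)]
  have hFval : ∀ n, ∫ t in Ioi 0, F n t = (b (n + 1) : ℂ) * (s ^ (α : ℂ))⁻¹ ^ (n + 1) := by
    intro n
    have hG : (Real.Gamma (e n) : ℂ) ≠ 0 := by exact_mod_cast (Real.Gamma_pos_of_pos (he n)).ne'
    simp only [hFc]
    rw [integral_const_mul, laplace_rpow (he n) hs0, hpow, inv_pow]
    simp only [c]
    change ((b (n + 1) / Real.Gamma (e n) : ℝ) : ℂ) * _ = _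
    rw [Complex.ofReal_div, mul_comm (_⁻¹) (Real.Gamma (e n) : ℂ), ← mul_assoc,
      div_mul_cancel₀ _ hG]
  have hFnorm : ∀ n, ∫ t in Ioi 0, ‖F n t‖ = |b (n + 1)| * (s.re ^ α)⁻¹ ^ (n + 1) := by
    intro n
    have h1 : ∀ t ∈ Ioi (0 : ℝ), ‖F n t‖ = |c n| * (t ^ (e n - 1) * Real.exp (-(s.re * t))) := by
      intro t (ht : 0 < t)
      rw [norm_laplace_integrand (f n), abs_mul, abs_of_nonneg (Real.rpow_nonneg ht.le _)]
      ring
    have hG := Real.Gamma_pos_of_pos (he n)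
    have h2 : |c n| * Real.Gamma (e n) = |b (n + 1)| := by
      change |b (n + 1) / Real.Gamma (e n)| * _ = _
      rw [abs_div, abs_of_pos hG, div_mul_cancel₀ _ hG.ne']
    rw [setIntegral_congr_fun measurableSet_Ioi h1, integral_const_mul,
      Real.integral_rpow_mul_exp_neg_mul_Ioi (he n) hs0, mul_left_comm, h2, mul_comm, one_div,
      Real.inv_rpow hs0.le, inv_pow, ← Real.rpow_mul_natCast hs0.le]
  have hFsum : Summable fun n => ∫ t in Ioi 0, ‖F n t‖ := by
    simp only [hFnorm]
    refine Summable.of_nonneg_of_le (fun n => by positivity) (fun n => ?_)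
      ((summable_nat_add_iff 1).2 hb)
    gcongr
  have hker : ∀ t, ∑' n, F n t = Complex.exp (-s * t) * ((∑' n, f n t : ℝ) : ℂ) := by
    intro t
    rw [Complex.ofReal_tsum, ← tsum_mul_left]
  have hval := hasSum_integral_of_summable_integral_norm hFint hFsum
  simp only [hker, hFval] at hval
  refine ⟨?_, ?_⟩
  · simpa only [IntegrableOn, hker] using integrable_tsum_of_summable_integral_norm hFint hFsum
  · have h1 := hval.tsum_eq
    have h2 := hsum.tsum_eq
    rw [hsum.summable.tsum_eq_zero_add, h1] at h2
    simpa using h2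

/-- A proper rational function is a convergent power series with real coefficients in `s⁻¹` near
infinity, since `x ↦ Z(1 / x)` is the quotient of the reversed polynomials. -/
lemma exists_hasSum_transferFunction_of_proper {Z : RatFunc ℝ}
    (hZ : Z.num.natDegree ≤ Z.denom.natDegree) :
    ∃ (b : ℕ → ℝ) (R : ℝ), 0 < R ∧ (Summable fun n => |b n| * R ^ n) ∧
      ∀ y : ℂ, y ≠ 0 → ‖y⁻¹‖ ≤ R →
        HasSum (fun n => (b n : ℂ) * y⁻¹ ^ n) (transferFunction Z y) := by
  set N := Z.num.reflect Z.denom.natDegree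
  set D := Z.denom.reverse
  let G : ℂ → ℂ := fun x => aeval x N / aeval x D
  have hG : ∀ y : ℂ, y ≠ 0 → transferFunction Z y = G y⁻¹ := by
    intro y hy
    let := invertibleOfNonzero hy
    have h1 := eval₂_reflect_mul_pow (algebraMap ℝ ℂ) y Z.denom.natDegree Z.num hZ
    have h2 := eval₂_reverse_mul_pow (algebraMap ℝ ℂ) y Z.denom
    rw [invOf_eq_inv] at h1 h2
    rw [transferFunction_eq_div, aeval_def, aeval_def, ← h1, ← h2,
      mul_div_mul_right _ _ (pow_ne_zero _ hy)]
    rfl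
  have hD0 : aeval (0 : ℂ) D ≠ 0 := by
    rw [← coeff_zero_eq_aeval_zero', coeff_zero_reverse]
    simpa using Z.denom_ne_zero
  have hconj : ∀ x, (starRingEnd ℂ) (G ((starRingEnd ℂ) x)) = G x := by
    intro x
    have : ∀ p : ℝ[X], (starRingEnd ℂ) (aeval ((starRingEnd ℂ) x) p) = aeval x p := by
      intro p
      rw [aeval_conj, Complex.conj_conj]
    simp only [G, map_div₀, this]
  have hGan : AnalyticAt ℂ G 0 :=
    ((Polynomial.differentiable_aeval N).analyticAt 0).div
      ((Polynomial.differentiable_aeval D).analyticAt 0) hD0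
  obtain ⟨p, r, hp⟩ := hGan
  obtain ⟨R, hR0, hRr⟩ := ENNReal.lt_iff_exists_nnreal_btwn.1 hp.r_pos
  have hR : (0 : ℝ) < R := by exact_mod_cast hR0
  refine ⟨fun n => (p.coeff n).re, R, hR, ?_, fun y hy hyR => ?_⟩
  · refine Summable.of_nonneg_of_le (fun n => by positivity) (fun n => ?_)
      (p.summable_norm_mul_pow (hRr.trans_le hp.r_le))
    gcongr
    rw [FormalMultilinearSeries.norm_apply_eq_norm_coef]
    exact Complex.abs_re_le_norm _
  · have hs : ∀ x : ℂ, ‖x‖ ≤ R → HasSum (fun n => p.coeff n * x ^ n) (G x) := by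
      intro x hx
      have hx' : x ∈ Metric.eball (0 : ℂ) r := by
        rw [mem_eball_zero_iff]
        refine lt_of_le_of_lt ?_ hRr
        rw [enorm_eq_nnnorm]
        exact_mod_cast hx
      have := hp.hasSum hx'
      simpa [FormalMultilinearSeries.apply_eq_pow_smul_coeff, mul_comm] using this
    rw [hG y hy]
    -- by the symmetry `hconj`, averaging with the conjugate series makes the coefficients real
    have h1 := hs _ hyR
    have h2 := (hs ((starRingEnd ℂ) y⁻¹) (by rwa [RCLike.norm_conj])).map (starRingEnd ℂ)
      Complex.continuous_conj
    rw [hconj] at h2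
    have h3 := (h1.add h2).mul_left (1 / 2)
    rw [← two_mul, one_div, inv_mul_cancel_left₀ two_ne_zero] at h3
    refine h3.congr_fun fun n => ?_
    simp only [Function.comp, map_mul, map_pow, Complex.conj_conj]
    rw [Complex.re_eq_add_conj]
    ring

/-! ### The fractional order transfer function -/

lemma cpow_re_pos {α : ℝ} (hα₀ : 0 < α) (hα₁ : α < 1) {s : ℂ} (hs : 0 < s.re) :
    0 < (s ^ (α : ℂ)).re := by
  have hs0 : s ≠ 0 := by rintro rfl; simp at hs
  have harg := Complex.abs_arg_lt_pi_div_two_iff.2 (Or.inl hs)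
  rw [Complex.cpow_ofReal_re]
  refine mul_pos (Real.rpow_pos_of_pos (norm_pos_iff.2 hs0) _) (Real.cos_pos_of_mem_Ioo ?_)
  have h : |s.arg * α| < Real.pi / 2 := by
    rw [abs_mul, abs_of_pos hα₀]
    exact (mul_le_of_le_one_right (abs_nonneg _) hα₁.le).trans_lt harg
  exact ⟨(abs_lt.1 h).1, (abs_lt.1 h).2⟩

/-- Subordination: `s ↦ ∫ e^{-τ s ^ α} k(τ) dτ` inherits positivity from `k`. -/
lemma hausdorffPositive_laplace_rpow {α : ℝ} (hα : α ∈ Ioo (0 : ℝ) 1) {k : ℝ → ℝ}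
    (hk : IntegrableOn k (Ioi 0)) (hk0 : ∀ᵐ t ∂volume.restrict (Ioi (0 : ℝ)), 0 ≤ k t) :
    HausdorffPositive fun s => ∫ τ in Ioi (0 : ℝ), Real.exp (-(s ^ α * τ)) * k τ := by
  refine HausdorffPositive.integral (Φ := fun τ s => Real.exp (-(s ^ α * τ)) * k τ) ?_
    fun s hs => integrableOn_exp_mul_of_nonneg hk (Real.rpow_nonneg hs.le _)
  filter_upwards [hk0, ae_restrict_mem measurableSet_Ioi] with τ hτ (hτ0 : 0 < τ)
  exact ((HausdorffMultiplier.exp_neg_mul_rpow hα hτ0.le).mul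
    (HausdorffMultiplier.const hτ)).hausdorffPositive

section Fractional

variable {Z : RatFunc ℝ} {z w : ImpulseResponse} {α : ℝ}

lemma exists_isResponseOf_fractionalTransferFunction
    (hz : z.IsResponseOf (transferFunction Z)) (hk : IntegrableOn z.kernel (Ioi 0)) (hα₀ : 0 < α) :
    ∃ w : ImpulseResponse, w.IsResponseOf (fractionalTransferFunction Z α) := by
  obtain ⟨b, R, hR, hb, hsum⟩ :=
    exists_hasSum_transferFunction_of_proper (natDegree_num_le_natDegree_denom hz hk)
  refine exists_isResponseOf_of_hasSum hR hα₀ hb fun s hs hsR => hsum _ ?_ hsR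
  exact Complex.cpow_ne_zero_iff.2 (Or.inl (by rintro rfl; simp at hs))

/-- The relation between the two Laplace transforms on the real axis, which is what is left of
`Z(s ^ α)` after the direct terms, matched at infinity, are cancelled. -/
lemma direct_eq_and_laplace_eq (hz : z.IsResponseOf (transferFunction Z))
    (hk : IntegrableOn z.kernel (Ioi 0)) (hα₀ : 0 < α)
    (hw : w.IsResponseOf (fractionalTransferFunction Z α)) :
    w.direct = z.direct ∧ ∃ σ : ℝ, ∀ s : ℝ, σ < s →
      IntegrableOn (fun t => Real.exp (-(s * t)) * w.kernel t) (Ioi 0) ∧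
      ∫ t in Ioi (0 : ℝ), Real.exp (-(s * t)) * w.kernel t =
        ∫ τ in Ioi (0 : ℝ), Real.exp (-(s ^ α * τ)) * z.kernel τ := by
  obtain ⟨σ, hσ⟩ := hw.real
  have heq : ∀ s : ℝ, max σ 0 < s →
      w.direct + ∫ t in Ioi (0 : ℝ), Real.exp (-(s * t)) * w.kernel t =
        z.direct + ∫ τ in Ioi (0 : ℝ), Real.exp (-(s ^ α * τ)) * z.kernel τ := by
    intro s hs
    have hs0 : 0 < s := (le_max_right _ _).trans_lt hs
    have h1 := (hσ s ((le_max_left _ _).trans_lt hs)).2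
    rw [fractionalTransferFunction, ← Complex.ofReal_cpow hs0.le, transferFunction_eq_laplace hz hk
      (by simpa using Real.rpow_pos_of_pos hs0 α)] at h1
    simp only [laplace_integrand_ofReal, integral_complex_ofReal] at h1
    exact_mod_cast h1
  have hdirect : w.direct = z.direct := by
    have h1 := (tendsto_laplace_atTop (hσ (σ + 1) (by linarith)).1).const_add w.direct
    have h2 := ((tendsto_laplace_atTop (s₀ := 0) (k := z.kernel)
      (by simpa using hk)).const_add z.direct).comp (tendsto_rpow_atTop hα₀)
    rw [add_zero] at h1 h2
    refine tendsto_nhds_unique h1 (h2.congr' ?_)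
    filter_upwards [eventually_gt_atTop (max σ 0)] with s hs using (heq s hs).symm
  refine ⟨hdirect, max σ 0, fun s hs => ⟨(hσ s ((le_max_left _ _).trans_lt hs)).1, ?_⟩⟩
  have := heq s hs
  rw [hdirect] at this
  exact add_left_cancel this

/-- Conservation of mass: both sides are the limit of `Z(s ^ α)` at `0`, which is reached from the
right half-plane of the definition by analytic continuation. -/
lemma direct_add_integral_kernel_eq (hz : z.IsResponseOf (transferFunction Z))
    (hk : IntegrableOn z.kernel (Ioi 0)) (hα₀ : 0 < α) (hα₁ : α < 1)
    (hw : w.IsResponseOf (fractionalTransferFunction Z α))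
    (hwk : IntegrableOn w.kernel (Ioi 0)) :
    w.direct + ∫ t in Ioi (0 : ℝ), w.kernel t = z.direct + ∫ t in Ioi (0 : ℝ), z.kernel t := by
  obtain ⟨σ, hσ⟩ := hw
  have hpow : DifferentiableOn ℂ (fun s : ℂ => s ^ (α : ℂ)) {s | 0 < s.re} := fun s hs =>
    (differentiableAt_id.cpow_const (Or.inl hs)).differentiableWithinAt
  have hEq := eqOn_re_pos_of_eq_of_lt_re (σ := max σ 0)
    (f := fun s => w.direct + ∫ t in Ioi (0 : ℝ), Complex.exp (-s * t) * (w.kernel t : ℂ))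
    (g := fun s => z.direct +
      ∫ t in Ioi (0 : ℝ), Complex.exp (-(s ^ (α : ℂ)) * t) * (z.kernel t : ℂ))
    ((differentiableOn_const _).add (differentiableOn_laplace hwk))
    ((differentiableOn_const _).add ((differentiableOn_laplace hk).comp hpow
      fun s hs => cpow_re_pos hα₀ hα₁ hs)) fun s hs => by
        rw [(hσ s ((le_max_left _ _).trans_lt hs)).2, fractionalTransferFunction,
          transferFunction_eq_laplace hz hk
            (cpow_re_pos hα₀ hα₁ ((le_max_right _ _).trans_lt hs))]
  have hreal : ∀ s : ℝ, 0 < s →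
      w.direct + ∫ t in Ioi (0 : ℝ), Real.exp (-(s * t)) * w.kernel t =
        z.direct + ∫ τ in Ioi (0 : ℝ), Real.exp (-(s ^ α * τ)) * z.kernel τ := by
    intro s hs
    have h := hEq (by simpa using hs : (s : ℂ) ∈ {s : ℂ | 0 < s.re})
    simp only [← Complex.ofReal_cpow hs.le, laplace_integrand_ofReal,
      integral_complex_ofReal] at h
    exact_mod_cast h
  have hpow0 : Tendsto (fun s : ℝ => s ^ α) (𝓝[>] 0) (𝓝[>] 0) := by
    refine tendsto_nhdsWithin_iff.2 ⟨?_, ?_⟩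
    · have := (Real.continuous_rpow_const hα₀.le).tendsto 0
      rw [Real.zero_rpow hα₀.ne'] at this
      exact this.mono_left nhdsWithin_le_nhds
    · filter_upwards [self_mem_nhdsWithin] with s hs using Real.rpow_pos_of_pos hs α
  refine tendsto_nhds_unique ((tendsto_laplace_nhdsGT_zero hwk).const_add _)
    ((((tendsto_laplace_nhdsGT_zero hk).comp hpow0).const_add _).congr' ?_)
  filter_upwards [self_mem_nhdsWithin] with s hs using (hreal s hs).symm

end Fractional

theorem mainTheorem6 (Z : RatFunc ℝ) (z : ImpulseResponse)
    (hz : z.IsResponseOf (transferFunction Z)) (hstable : z.BIBOStable) (hnonneg : z.Nonneg)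
    (α : ℝ) (hα₀ : 0 < α) (hα₁ : α < 1) :
    Z.denom.eval 0 ≠ 0 ∧
    (∃ w : ImpulseResponse, w.IsResponseOf (fractionalTransferFunction Z α)) ∧
    ∀ w : ImpulseResponse, w.IsResponseOf (fractionalTransferFunction Z α) →
      w.Nonneg ∧ w.MemL1 ∧ w.l1Norm = Z.eval (RingHom.id ℝ) 0 := by
  have hk := hstable.integrableOn hz hnonneg
  obtain ⟨hpole, hZ0⟩ := eval_zero_of_integrable hz hk
  refine ⟨hpole, exists_isResponseOf_fractionalTransferFunction hz hk hα₀, fun w hw => ?_⟩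
  obtain ⟨hdirect, σ, hσ⟩ := direct_eq_and_laplace_eq hz hk hα₀ hw
  have hpos := hausdorffPositive_laplace_rpow ⟨hα₀, hα₁⟩ hk hnonneg.ae_Ioi
  have hbound : ∀ s : ℝ, 0 < s → ∫ τ in Ioi (0 : ℝ), Real.exp (-(s ^ α * τ)) * z.kernel τ ≤
      ∫ τ in Ioi (0 : ℝ), z.kernel τ := by
    intro s hs
    refine integral_mono_ae
      (integrableOn_exp_mul_of_nonneg hk (Real.rpow_nonneg hs.le _)) hk ?_
    filter_upwards [hnonneg.ae_Ioi, ae_restrict_mem measurableSet_Ioi] with τ h (hτ : 0 < τ)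
    exact mul_le_of_le_one_left h (Real.exp_le_one_iff.2
      (neg_nonpos.2 (mul_nonneg (Real.rpow_nonneg hs.le _) hτ.le)))
  have hw0 := hpos.ae_nonneg (fun s hs => (hσ s hs).1) fun s hs => (hσ s hs).2
  have hwk := hpos.integrableOn hbound (fun s hs => (hσ s hs).1) fun s hs => (hσ s hs).2
  have hd0 : 0 ≤ w.direct := hdirect ▸ hnonneg.1
  refine ⟨⟨hd0, ?_⟩, hwk.congr_set_ae Ioi_ae_eq_Ici.symm, ?_⟩
  · rwa [Measure.restrict_congr_set Ioi_ae_eq_Ici.symm]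
  · rw [hZ0, ← direct_add_integral_kernel_eq hz hk hα₀ hα₁ hw hwk, ImpulseResponse.l1Norm,
      integral_Ici_eq_integral_Ioi, abs_of_nonneg hd0,
      integral_congr_ae (hw0.mono fun t ht => abs_of_nonneg ht)]
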